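/- Let $B(t)$, $t\ge 0$, be a real-valued Brownian motion with variance $1$ at $t=1$, i.e. a centered Gaussian process with $B(0)=0$ a.s. and $\mathbb E|B(t)-B(s)|^2=|t-s|$, on a probability space $(\Omega,\mathcal F,\mathbb P)$. Let $\alpha\in(0,1)$ and let $\Upsilon=\Upsilon(t,r)$ be a deterministic real function. For $p>0$ and $t>r>0$ put $${}_rD_t^{-p}\Upsilon(t,r)=\frac1{\Gamma(p)}\int_r^t (t-s)^{p-1}\Upsilon(s,r)\,ds,\qquad {}_rD_t^{1-\alpha}\Upsilon(t,r)=\frac{\partial}{\partial t}\,{}_rD_t^{-\alpha}\Upsilon(t,r).$$ Assume that: 1. for all $0<r<t$ the integral ${}_rD_t^{-\alpha}\Upsilon(t,r)$ converges absolutely and is differentiable in $t$, and $\Upsilon(t,r)$ and ${}_rD_t^{1-\alpha}\Upsilon(t,r)$ are continuous on the region $\{(t,r):0<r<t\}$; 2. for every $t>0$ the Wiener integrals $$X(t)=\int_0^t\Upsilon(t,r)\,dB(r),\qquad A(t)=\int_0^t{}_rD_t^{1-\alpha}\Upsilon(t,r)\,dB(r)$$ are well-defined, i.e. both integrands belong to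 $L_2(0,t)$, and $A(t)\,dt$ is a well-defined term of a stochastic differential on $(0,\infty)$, i.e. $\int_s^t\big(\int_0^u|{}_rD_u^{1-\alpha}\Upsilon(u,r)|^2dr\big)^{1/2}du<\infty$ for all $0<s<t$; 3. for every $t>0$, $\displaystyle\int_0^t(t-s)^{\alpha-1}\Big(\int_0^s|\Upsilon(s,r)|^2\,dr\Big)^{1/2}ds<\infty$; 4. for every $t>0$ the finite limit $b(t)=\lim_{r\uparrow t}{}_rD_t^{-\alpha}\Upsilon(t,r)$ exists. Then $$D_t^{1-\alpha}\Big(\int_0^t\Upsilon(t,r)\,dB(r)\Big)dt\simeq\Big(\int_0^t{}_rD_t^{1-\alpha}\Upsilon(t,r)\,dB(r)\Big)dt+\Big(\lim_{r\uparrow t}{}_rD_t^{-\alpha}\Upsilon(t,r)\Big)dB(t),\qquad t>0,$$ in the following sense. The fractional integral $J(t)=\frac1{\Gamma(\alpha)}\int_0^t(t-s)^{\alpha-1}X(s)\,ds$, whose stochastic differential is by definition $D_t^{1-\alpha}(X(t))\,dt$, exists for all $t>0$ as a Bochner integral in $L_2(\Omega)$; for all $0<s\le t$ the process $A$ is Bochner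 integrable on $[s,t]$ in $L_2(\Omega)$ and $b\in L_2(s,t)$; and $$J(t)-J(s)=\int_s^tA(u)\,du+\int_s^tb(u)\,dB(u)\quad\text{almost surely.}$$ In particular, for any finite family of intervals $[s_i,t_i]$ with $0<s_i\le t_i$, the random vectors of the left-hand sides and of the right-hand sides are equal in distribution. -/

import Mathlib

open MeasureTheory ProbabilityTheory Set Filter Topology
open scoped NNReal ENNReal

/-- The fractional integral of order `p` with lower terminal `a`,
`t ↦ (1 / Γ(p)) ∫_a^t (t - s)^(p - 1) f(s) ds` (a Bochner integral), for functions with values in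
a real Banach space. It is used for real functions and for `L²(Ω)`-valued processes. -/
noncomputable def rlIntegral {E : Type*} [NormedAddCommGroup E] [NormedSpace ℝ E]
    (p a : ℝ) (f : ℝ → E) (t : ℝ) : E :=
  (Real.Gamma p)⁻¹ • ∫ s in a..t, (t - s) ^ (p - 1) • f s

/-- The Riemann–Liouville derivative of order `β ∈ [0, 1)` with lower terminal `a`:
`(d/dt) (1 / Γ(1 - β)) ∫_a^t (t - s)^(-β) f(s) ds`. -/
noncomputable def rlDeriv (β a : ℝ) (f : ℝ → ℝ) (t : ℝ) : ℝ :=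
  deriv (rlIntegral (1 - β) a f) t

/-- The Riemann–Liouville derivative of order `β` with lower terminal `a` of `f` exists at `t`:
the integral converges absolutely and it is differentiable in its upper terminal. -/
def HasRLDeriv (β a : ℝ) (f : ℝ → ℝ) (t : ℝ) : Prop :=
  IntervalIntegrable (fun s => (t - s) ^ (-β) * f s) volume a t ∧
    DifferentiableAt ℝ (rlIntegral (1 - β) a f) t

/-- The Riemann–Liouville derivative `ᵣD_t^{1-α} Υ(t, r)` of a kernel in its first variable,
with lower terminal equal to its second variable. -/
noncomputable def kernelDeriv (α : ℝ) (Υ : ℝ → ℝ → ℝ) (t r : ℝ) : ℝ :=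
  rlDeriv (1 - α) r (fun s => Υ s r) t

/-- Lebesgue measure on the time axis `(0, ∞)`. -/
noncomputable abbrev timeMeasure : Measure ℝ := volume.restrict (Ioi (0 : ℝ))

theorem Ioc_inter_Ioi_zero (t : ℝ) : Ioc 0 t ∩ Ioi 0 = Ioc 0 t :=
  inter_eq_left.2 fun _ hx => hx.1

theorem timeMeasure_Ioc_ne_top (t : ℝ) : timeMeasure (Ioc 0 t) ≠ ∞ := by
  rw [timeMeasure, Measure.restrict_apply measurableSet_Ioc]
  exact ((measure_mono inter_subset_left).trans_lt measure_Ioc_lt_top).ne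

/-- Step functions: the formal combination `∑ cₜ [t]` is sent to `∑ cₜ 1_{(0, t]}`. -/
noncomputable def stepFunction : (ℝ≥0 →₀ ℝ) →ₗ[ℝ] Lp ℝ 2 timeMeasure :=
  Finsupp.linearCombination ℝ fun t : ℝ≥0 =>
    indicatorConstLp 2 (measurableSet_Ioc (a := (0 : ℝ)) (b := (t : ℝ)))
      (timeMeasure_Ioc_ne_top t) (1 : ℝ)

section Wiener

variable {Ω : Type*} [MeasurableSpace Ω] {P : Measure Ω} {B : ℝ≥0 → Ω → ℝ}

theorem brownian_memLp (hB : IsPreBrownianReal B P) (t : ℝ≥0) : MemLp (B t) 2 P :=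
  (hB.isGaussianProcess.hasGaussianLaw_eval t).memLp_two

/-- The elementary Wiener integral: the step function `∑ cₜ 1_{(0, t]}` has integral
`∑ cₜ B(t)`. -/
noncomputable def stepIntegral (hB : IsPreBrownianReal B P) : (ℝ≥0 →₀ ℝ) →ₗ[ℝ] Lp ℝ 2 P :=
  Finsupp.linearCombination ℝ fun t : ℝ≥0 => (brownian_memLp hB t).toLp (B t)

theorem inner_brownian (hB : IsPreBrownianReal B P) (s t : ℝ≥0) :
    inner ℝ ((brownian_memLp hB s).toLp (B s)) ((brownian_memLp hB t).toLp (B t))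
      = ((min s t : ℝ≥0) : ℝ) := by
  have : IsProbabilityMeasure P := hB.isGaussianProcess.isProbabilityMeasure
  have h := hB.covariance_eval s t
  rw [covariance_eq_sub (brownian_memLp hB s) (brownian_memLp hB t), hB.integral_eval,
    hB.integral_eval] at h
  rw [L2.inner_def, ← h]
  simp only [mul_zero, sub_zero]
  refine integral_congr_ae ?_
  filter_upwards [(brownian_memLp hB s).coeFn_toLp, (brownian_memLp hB t).coeFn_toLp]
    with ω h1 h2
  simp [h1, h2, mul_comm]

theorem inner_step (s t : ℝ≥0) :
    inner ℝ (indicatorConstLp (μ := timeMeasure) 2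
        (measurableSet_Ioc (a := (0 : ℝ)) (b := (s : ℝ))) (timeMeasure_Ioc_ne_top s) (1 : ℝ))
      (indicatorConstLp (μ := timeMeasure) 2
        (measurableSet_Ioc (a := (0 : ℝ)) (b := (t : ℝ))) (timeMeasure_Ioc_ne_top t) (1 : ℝ))
      = ((min s t : ℝ≥0) : ℝ) := by
  rw [L2.real_inner_indicatorConstLp_one_indicatorConstLp_one measurableSet_Ioc
    measurableSet_Ioc (timeMeasure_Ioc_ne_top s) (timeMeasure_Ioc_ne_top t)]
  rw [Ioc_inter_Ioc, measureReal_def, Measure.restrict_apply measurableSet_Ioc, max_self,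
    Ioc_inter_Ioi_zero]
  rw [Real.volume_Ioc, ENNReal.toReal_ofReal] <;> simp

theorem norm_stepIntegral (hB : IsPreBrownianReal B P) (c : ℝ≥0 →₀ ℝ) :
    ‖stepIntegral hB c‖ = ‖stepFunction c‖ := by
  have h : inner ℝ (stepIntegral hB c) (stepIntegral hB c)
      = inner ℝ (stepFunction c) (stepFunction c) := by
    simp only [stepIntegral, stepFunction, Finsupp.linearCombination_apply, Finsupp.sum,
      sum_inner, inner_sum, real_inner_smul_left, real_inner_smul_right, inner_step]
    refine Finset.sum_congr rfl fun x _ => Finset.sum_congr rfl fun y _ => ?_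
    rw [inner_brownian hB]
  rw [real_inner_self_eq_norm_sq, real_inner_self_eq_norm_sq] at h
  exact (sq_eq_sq₀ (norm_nonneg _) (norm_nonneg _)).1 h

theorem denseRange_stepFunction : DenseRange stepFunction := by
  have key : (LinearMap.range stepFunction).topologicalClosure = ⊤ := by
    rw [Submodule.topologicalClosure_eq_top_iff, Submodule.eq_bot_iff]
    intro g hg
    rw [Submodule.mem_orthogonal] at hg
    have h0 : ∀ t : ℝ, 0 ≤ t → ∫ x in (0 : ℝ)..t, g x = 0 := by
      intro t ht
      lift t to ℝ≥0 using ht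
      have h1 := hg (stepFunction (Finsupp.single t 1)) ⟨_, rfl⟩
      rw [stepFunction, Finsupp.linearCombination_single, one_smul,
        L2.inner_indicatorConstLp_one] at h1
      rw [intervalIntegral.integral_of_le t.coe_nonneg]
      rwa [Measure.restrict_restrict measurableSet_Ioc,
        Ioc_inter_Ioi_zero] at h1
    have hint : ∀ n : ℕ, IntervalIntegrable g volume 0 n := by
      intro n
      have h1 := integrableOn_Lp_of_measure_ne_top g fact_one_le_two_ennreal.elim
        (timeMeasure_Ioc_ne_top n)
      rw [IntegrableOn, Measure.restrict_restrict measurableSet_Ioc,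
        Ioc_inter_Ioi_zero] at h1
      exact (intervalIntegrable_iff_integrableOn_Ioc_of_le (by positivity)).2 h1
    have hae : ∀ᵐ x : ℝ, ∀ n : ℕ, x ∈ uIcc (0 : ℝ) n → ∀ c ∈ uIcc (0 : ℝ) n,
        HasDerivAt (fun u => ∫ y in c..u, g y) (g x) x :=
      ae_all_iff.2 fun n => (hint n).ae_hasDerivAt_integral
    rw [Lp.eq_zero_iff_ae_eq_zero]
    rw [Filter.EventuallyEq, ae_restrict_iff' measurableSet_Ioi]
    filter_upwards [hae] with x hx hx0
    obtain ⟨n, hn⟩ := exists_nat_ge x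
    have hd := hx n (by rw [uIcc_of_le (by positivity)]; exact ⟨hx0.le, hn⟩) 0 left_mem_uIcc
    have hz : HasDerivAt (fun u => ∫ y in (0 : ℝ)..u, g y) 0 x := by
      refine (hasDerivAt_const x (0 : ℝ)).congr_of_eventuallyEq ?_
      filter_upwards [Ioi_mem_nhds hx0] with u hu
      exact h0 u (le_of_lt hu)
    exact hd.unique hz
  exact Submodule.dense_iff_topologicalClosure_eq_top.2 key

/-- The Wiener integral over `(0, ∞)`, as the unique continuous linear extension to
`L²(0, ∞)` of the elementary Wiener integral. -/
noncomputable def wienerMap (hB : IsPreBrownianReal B P) :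
    Lp ℝ 2 timeMeasure →L[ℝ] Lp ℝ 2 P :=
  (stepIntegral hB).extendOfNorm stepFunction

theorem wienerMap_stepFunction (hB : IsPreBrownianReal B P) (c : ℝ≥0 →₀ ℝ) :
    wienerMap hB (stepFunction c) = stepIntegral hB c :=
  LinearMap.extendOfNorm_eq denseRange_stepFunction
    ⟨1, fun x => by rw [one_mul, norm_stepIntegral]⟩ c

/-- The Itô isometry, for deterministic integrands. -/
theorem norm_wienerMap (hB : IsPreBrownianReal B P) (f : Lp ℝ 2 timeMeasure) :
    ‖wienerMap hB f‖ = ‖f‖ := by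
  refine denseRange_stepFunction.induction_on (p := fun f => ‖wienerMap hB f‖ = ‖f‖) f
    (isClosed_eq (by fun_prop) (by fun_prop)) fun c => ?_
  rw [wienerMap_stepFunction, norm_stepIntegral]

open Classical in
/-- The Wiener integral `∫_a^b f(r) dB(r)`, `0 ≤ a ≤ b`, as an element of `L²(Ω)`; it is defined
for `f ∈ L²(a, b)`, and is `0` by convention otherwise. -/
noncomputable def wienerIntegral (hB : IsPreBrownianReal B P) (a b : ℝ) (f : ℝ → ℝ) :
    Lp ℝ 2 P :=
  if h : MemLp ((Ioc a b).indicator f) 2 timeMeasure then wienerMap hB h.toLp else 0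

end Wiener

/-! The Wiener integral is a continuous linear map on `L²(0, ∞)`, so it commutes with Bochner
integrals. The claim therefore reduces to a deterministic identity in `L²(0, ∞)`,
`ae_rlIntegral_kernelLp_sub`: the increment of the fractional integral of the sections `Υ(s, ·)`,
minus the integral of the sections of the derivative kernel, equals `1_{(s,t]} b`.

This identity is checked pointwise in `r`. By Fubini (`coeFn_integral_of_kernel`), the Bochner
integrals are a.e. Lebesgue integrals of the kernels. For a.e. `r` the derivative kernel is
integrable in time down to `r`, so the fractional integral `F(t, r)` has a limit `e(r)` as `t ↓ r`,
and `F(t, r) = e(r) + ∫_r^t` of its derivative.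

The hypothesis provides the other limit at the diagonal, `b(t)` as `r ↑ t`. The two need not agree
at every point, but they agree a.e. (`ae_eq_of_tendsto_diagonal`): against a test function, a
translation by `ε` turns the values `F(t, t - ε)` into `F(r + ε, r)`. -/

/-! ### Measurability and Bochner integration of `L²`-valued kernels. -/

theorem measurable_of_measurable_dist {S E : Type*} [MeasurableSpace S] [PseudoMetricSpace E]
    [SecondCountableTopology E] [MeasurableSpace E] [BorelSpace E] {g : S → E}
    (h : ∀ c, Measurable fun s => dist (g s) c) : Measurable g := by
  refine measurable_of_isOpen fun U hU => ?_
  choose! ε hε hεU using fun x (hx : x ∈ U) => Metric.isOpen_iff.1 hU x hx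
  -- By the Lindelöf property, countably many of these balls already cover `U`.
  obtain ⟨T, hTU, hT, hTeq⟩ := TopologicalSpace.isOpen_biUnion_countable U
    (fun x => Metric.ball x (ε x)) fun x _ => Metric.isOpen_ball
  have hUeq : U = ⋃ x ∈ T, Metric.ball x (ε x) := by
    rw [hTeq]
    refine Subset.antisymm (fun x hx => ?_) (iUnion₂_subset hεU)
    exact mem_biUnion hx (Metric.mem_ball_self (hε x hx))
  rw [hUeq, preimage_iUnion₂]
  exact MeasurableSet.biUnion hT fun x _ => measurableSet_lt (h x) measurable_const

section Kernel

variable {S R : Type*} [MeasurableSpace S] [MeasurableSpace R] {μ : Measure S} {ν : Measure R}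

theorem norm_eq_sqrt_integral_sq {f : Lp ℝ 2 ν} {k : R → ℝ} (h : f =ᵐ[ν] k) :
    ‖f‖ = √(∫ r, k r ^ 2 ∂ν) := by
  have h1 : ∫ r, k r ^ 2 ∂ν = ‖f‖ ^ 2 := by
    rw [← real_inner_self_eq_norm_sq, L2.inner_def]
    refine integral_congr_ae ?_
    filter_upwards [h] with r hr
    simp [hr, sq]
  rw [h1, Real.sqrt_sq (norm_nonneg _)]

theorem setIntegral_abs_le_norm (f : Lp ℝ 2 ν) {C : Set R} (hC : MeasurableSet C)
    (hνC : ν C ≠ ∞) : ∫ r in C, |f r| ∂ν ≤ ‖indicatorConstLp 2 hC hνC (1 : ℝ)‖ * ‖f‖ := by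
  have h1 : ∫ r in C, |f r| ∂ν = inner ℝ (indicatorConstLp 2 hC hνC (1 : ℝ)) |f| := by
    rw [L2.inner_indicatorConstLp_one]
    refine integral_congr_ae (ae_restrict_of_ae ?_)
    filter_upwards [Lp.coeFn_abs f] with r hr
    rw [hr]
  rw [h1, ← norm_abs_eq_norm f]
  exact real_inner_le_norm _ _

/-- An `L²`-valued function given by a jointly measurable kernel is strongly measurable. -/
theorem stronglyMeasurable_of_kernel [MeasurableSpace.CountablyGenerated R] [SigmaFinite ν]
    {K : S → R → ℝ} (hK : Measurable (Function.uncurry K)) {g : S → Lp ℝ 2 ν}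
    (hg : ∀ s, g s =ᵐ[ν] K s) : StronglyMeasurable g := by
  have : Fact ((2 : ℝ≥0∞) ≠ ∞) := ⟨by simp⟩
  let _ : MeasurableSpace (Lp ℝ 2 ν) := borel _
  have : BorelSpace (Lp ℝ 2 ν) := ⟨rfl⟩
  refine (measurable_of_measurable_dist fun c => ?_).stronglyMeasurable
  -- Distances to a fixed element are parametric integrals of a jointly measurable function, hence
  -- measurable in `s`.
  have hd : ∀ s, dist (g s) c = √(∫ r, (K s r - c r) ^ 2 ∂ν) := fun s => by
    rw [dist_eq_norm]
    refine norm_eq_sqrt_integral_sq ?_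
    filter_upwards [Lp.coeFn_sub (g s) c, hg s] with r h1 h2
    rw [h1, Pi.sub_apply, h2]
  simp_rw [hd]
  refine Measurable.sqrt (StronglyMeasurable.measurable
    (StronglyMeasurable.integral_prod_right (f := fun s r => (K s r - c r) ^ 2) ?_))
  refine Measurable.stronglyMeasurable ?_
  have hc : Measurable (c : R → ℝ) := (Lp.stronglyMeasurable c).measurable
  exact (hK.sub (hc.comp measurable_snd)).pow_const 2

/-- Cauchy–Schwarz on the finite-measure set `C` bounds the `L¹(C)` norm of each section by a
constant times `‖g s‖`, which is integrable in `s`. This is the input for Fubini. -/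
theorem integrable_prod_restrict_of_kernel [SigmaFinite μ] [SigmaFinite ν] {K : S → R → ℝ}
    (hK : Measurable (Function.uncurry K)) {g : S → Lp ℝ 2 ν} (hg : ∀ s, g s =ᵐ[ν] K s)
    (hint : Integrable g μ) {C : Set R} (hC : MeasurableSet C) (hνC : ν C ≠ ∞) :
    Integrable (Function.uncurry K) (μ.prod (ν.restrict C)) := by
  rw [integrable_prod_iff hK.aestronglyMeasurable]
  constructor
  · refine Eventually.of_forall fun s => ?_
    exact (integrable_congr (ae_restrict_of_ae (hg s))).1
      (integrableOn_Lp_of_measure_ne_top (g s) fact_one_le_two_ennreal.elim hνC)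
  · refine (hint.norm.const_mul ‖indicatorConstLp 2 hC hνC (1 : ℝ)‖).mono'
      (hK.norm.stronglyMeasurable.integral_prod_right'.aestronglyMeasurable)
      (Eventually.of_forall fun s => ?_)
    rw [Real.norm_of_nonneg (integral_nonneg fun _ => norm_nonneg _)]
    refine le_trans (le_of_eq ?_) (setIntegral_abs_le_norm (g s) hC hνC)
    refine integral_congr_ae (ae_restrict_of_ae ?_)
    filter_upwards [hg s] with r hr
    rw [hr]; rfl

theorem ae_integrable_of_kernel [SigmaFinite μ] [SigmaFinite ν] {K : S → R → ℝ}
    (hK : Measurable (Function.uncurry K)) {g : S → Lp ℝ 2 ν} (hg : ∀ s, g s =ᵐ[ν] K s)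
    (hint : Integrable g μ) : ∀ᵐ r ∂ν, Integrable (fun s => K s r) μ := by
  have h : ∀ᵐ r ∂ν.restrict (⋃ n, spanningSets ν n), Integrable (fun s => K s r) μ := by
    rw [ae_restrict_iUnion_eq]
    simp only [eventually_iSup]
    exact fun n => (integrable_prod_restrict_of_kernel hK hg hint (measurableSet_spanningSets ν n)
      (measure_spanningSets_lt_top ν n).ne).prod_left_ae
  rwa [iUnion_spanningSets, Measure.restrict_univ] at h

/-- The Bochner integral of an `L²`-valued function given by a jointly measurable kernel is
almost everywhere the Lebesgue integral of the kernel. -/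
theorem coeFn_integral_of_kernel [SigmaFinite μ] [SigmaFinite ν] {K : S → R → ℝ}
    (hK : Measurable (Function.uncurry K)) {g : S → Lp ℝ 2 ν} (hg : ∀ s, g s =ᵐ[ν] K s)
    (hint : Integrable g μ) :
    ((∫ s, g s ∂μ : Lp ℝ 2 ν) : R → ℝ) =ᵐ[ν] fun r => ∫ s, K s r ∂μ := by
  refine ae_eq_of_forall_setIntegral_eq_of_sigmaFinite
    (fun C hC hνC => integrableOn_Lp_of_measure_ne_top _ fact_one_le_two_ennreal.elim hνC.ne)
    (fun C hC hνC =>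
      (integrable_prod_restrict_of_kernel hK hg hint hC hνC.ne).integral_prod_right)
    fun C hC hνC => ?_
  -- Pairing with the indicator of `C` passes inside the Bochner integral; Fubini on `μ × ν|_C` does
  -- the same for the Lebesgue integrals.
  rw [← L2.inner_indicatorConstLp_one hC hνC.ne, ← integral_inner hint,
    ← integral_integral_swap (integrable_prod_restrict_of_kernel hK hg hint hC hνC.ne)]
  refine integral_congr_ae (Eventually.of_forall fun s => ?_)
  simp only [L2.inner_indicatorConstLp_one]
  exact integral_congr_ae (ae_restrict_of_ae (hg s))

end Kernel

/-! ### One-sided limits at the diagonal. -/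

/-- If a measurable function of two variables has a limit at the diagonal from the left in
its second variable, and one from the right in its first variable, the two limits agree almost
everywhere. -/
theorem ae_eq_of_tendsto_diagonal {G : ℝ → ℝ → ℝ} (hG : Measurable (Function.uncurry G))
    {b e : ℝ → ℝ} (hb : ∀ t, 0 < t → Tendsto (fun r => G t r) (𝓝[<] t) (𝓝 (b t)))
    (he : ∀ᵐ r, 0 < r → Tendsto (fun t => G t r) (𝓝[>] r) (𝓝 (e r))) :
    ∀ᵐ r, 0 < r → b r = e r := by
  set ε : ℕ → ℝ := fun n => 1 / ((n : ℝ) + 1) with hε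
  have hε0 : ∀ n, 0 < ε n := fun n => by positivity
  have hε1 : ∀ n, ε n ≤ 1 := fun n => by
    rw [hε]; exact div_le_one_of_le₀ (by simp) (by positivity)
  have hεlim : Tendsto ε atTop (𝓝 0) := tendsto_one_div_add_atTop_nhds_zero_nat
  -- `G` has no bound near the diagonal; composing with the bounded injective `arctan` makes
  -- dominated convergence available and loses nothing.
  set h : ℕ → ℝ → ℝ := fun n r => Real.arctan (G (r + ε n) r) with hh
  have hmeas : ∀ n, Measurable (h n) := fun n =>
    Real.measurable_arctan.comp (hG.comp ((measurable_id.add_const _).prodMk measurable_id))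
  have hbound : ∀ x, ‖Real.arctan x‖ ≤ Real.pi / 2 := fun x => by
    rw [Real.norm_eq_abs, abs_le]
    exact ⟨(Real.neg_pi_div_two_lt_arctan x).le, (Real.arctan_lt_pi_div_two x).le⟩
  have hblim : ∀ t, 0 < t →
      Tendsto (fun n => h n (t - ε n)) atTop (𝓝 (Real.arctan (b t))) := fun t ht => by
    have h1 : Tendsto (fun n => t - ε n) atTop (𝓝[<] t) := by
      refine tendsto_nhdsWithin_iff.2 ⟨by simpa using hεlim.const_sub t, ?_⟩
      exact Eventually.of_forall fun n => by simpa using hε0 n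
    have h2 := (Real.continuous_arctan.tendsto _).comp ((hb t ht).comp h1)
    refine h2.congr fun n => ?_
    simp [hh]
  have helim : ∀ᵐ r, 0 < r → Tendsto (fun n => h n r) atTop (𝓝 (Real.arctan (e r))) := by
    filter_upwards [he] with r hr hr0
    have h1 : Tendsto (fun n => r + ε n) atTop (𝓝[>] r) := by
      refine tendsto_nhdsWithin_iff.2 ⟨by simpa using hεlim.const_add r, ?_⟩
      exact Eventually.of_forall fun n => by simpa using hε0 n
    exact (Real.continuous_arctan.tendsto _).comp ((hr hr0).comp h1)
  have hbm : AEStronglyMeasurable (fun t => Real.arctan (b t)) (volume.restrict (Ioi 0)) := by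
    refine aestronglyMeasurable_of_tendsto_ae atTop (f := fun n t => h n (t - ε n))
      (fun n => ((hmeas n).comp (measurable_id.sub_const _)).aestronglyMeasurable) ?_
    filter_upwards [ae_restrict_mem measurableSet_Ioi] with t ht using hblim t ht
  have hem : AEStronglyMeasurable (fun t => Real.arctan (e t)) (volume.restrict (Ioi 0)) := by
    refine aestronglyMeasurable_of_tendsto_ae atTop (f := h)
      (fun n => (hmeas n).aestronglyMeasurable) ?_
    exact (ae_restrict_iff' measurableSet_Ioi).2 helim
  have hloc : LocallyIntegrableOn (fun t => Real.arctan (b t) - Real.arctan (e t)) (Ioi 0)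
      volume := by
    rw [locallyIntegrableOn_iff isOpen_Ioi.isLocallyClosed]
    intro k hk hkc
    refine IntegrableOn.of_bound hkc.measure_lt_top
      ((hbm.sub hem).mono_measure (Measure.restrict_mono hk le_rfl)) Real.pi
      (Eventually.of_forall fun t => ?_)
    refine (norm_sub_le _ _).trans ?_
    linarith [hbound (b t), hbound (e t)]
  have key := isOpen_Ioi.ae_eq_zero_of_integral_contDiff_smul_eq_zero hloc
    fun φ hφ hφc hφs => ?_
  · filter_upwards [key] with r hr hr0
    exact Real.arctan_injective (sub_eq_zero.1 (hr hr0))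
  have hφcont : Continuous φ := hφ.continuous
  have hφ0 : ∀ t, t ≤ 0 → φ t = 0 := fun t ht =>
    image_eq_zero_of_notMem_tsupport fun h => not_lt.2 ht (hφs h)
  obtain ⟨M, hM⟩ := hφc.exists_bound_of_continuous hφcont
  obtain ⟨ρ, hρ⟩ : ∃ ρ, ∀ t, ρ < |t| → φ t = 0 := by
    obtain ⟨ρ, hρ⟩ := hφc.isCompact.isBounded.subset_closedBall 0
    refine ⟨ρ, fun t ht => image_eq_zero_of_notMem_tsupport fun h => ?_⟩
    have := hρ h
    rw [mem_closedBall_zero_iff, Real.norm_eq_abs] at this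
    linarith
  -- The radius `ρ + 1` contains the support of every shift of `φ` by at most `1`.
  set bd : ℝ → ℝ := (Icc (-(ρ + 1)) (ρ + 1)).indicator fun _ => M * (Real.pi / 2) with hbd
  have hbdint : Integrable bd :=
    (integrable_indicator_iff measurableSet_Icc).2 (integrableOn_const (by simp))
  have hM0 : 0 ≤ M := (norm_nonneg _).trans (hM 0)
  have hdom : ∀ δ, 0 ≤ δ → δ ≤ 1 → ∀ t x, ‖φ (t + δ) * Real.arctan x‖ ≤ bd t := by
    intro δ h0 h1 t x
    by_cases ht : t ∈ Icc (-(ρ + 1)) (ρ + 1)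
    · rw [hbd, indicator_of_mem ht, norm_mul]
      exact mul_le_mul (hM _) (hbound _) (norm_nonneg _) hM0
    · rw [hbd, indicator_of_notMem ht, hρ, zero_mul, norm_zero]
      rw [mem_Icc, ← abs_le, not_le, lt_abs] at ht
      rw [lt_abs]
      rcases ht with ht | ht
      · left; linarith
      · right; linarith
  have hdom0 : ∀ t x, ‖φ t * Real.arctan x‖ ≤ bd t := fun t x => by
    simpa using hdom 0 le_rfl zero_le_one t x
  have lim1 : Tendsto (fun n => ∫ t, φ t * h n (t - ε n)) atTop
      (𝓝 (∫ t, φ t * Real.arctan (b t))) := by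
    refine tendsto_integral_of_dominated_convergence bd (fun n => ?_) hbdint
      (fun n => Eventually.of_forall fun t => hdom0 _ _) (Eventually.of_forall fun t => ?_)
    · exact (hφcont.measurable.mul
        ((hmeas n).comp (measurable_id.sub_const _))).aestronglyMeasurable
    · rcases le_or_gt t 0 with ht | ht
      · simp [hφ0 t ht]
      · exact (hblim t ht).const_mul _
  have lim2 : Tendsto (fun n => ∫ t, φ (t + ε n) * h n t) atTop
      (𝓝 (∫ t, φ t * Real.arctan (e t))) := by
    refine tendsto_integral_of_dominated_convergence bd (fun n => ?_) hbdint
      (fun n => Eventually.of_forall fun t => hdom _ (hε0 n).le (hε1 n) _ _) ?_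
    · exact ((hφcont.measurable.comp (measurable_id.add_const _)).mul
        (hmeas n)).aestronglyMeasurable
    · filter_upwards [helim] with t ht
      have hφlim : Tendsto (fun n => φ (t + ε n)) atTop (𝓝 (φ t)) :=
        (hφcont.tendsto t).comp (by simpa using hεlim.const_add t)
      rcases le_or_gt t 0 with ht0 | ht0
      · rw [hφ0 t ht0] at hφlim
        rw [hφ0 t ht0, zero_mul]
        -- For `t ≤ 0` nothing is known about the limit of `h n t`; boundedness and `φ (t + ε n) →
        -- 0` suffice.
        refine squeeze_zero_norm (a := fun n => ‖φ (t + ε n)‖ * (Real.pi / 2)) (fun n => ?_) ?_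
        · rw [norm_mul]
          exact mul_le_mul_of_nonneg_left (hbound _) (norm_nonneg _)
        · simpa using hφlim.norm.mul_const (Real.pi / 2)
      · exact hφlim.mul (ht ht0)
  -- Translation invariance exchanges the two ways of approaching the diagonal.
  have heq : ∀ n, ∫ t, φ t * h n (t - ε n) = ∫ t, φ (t + ε n) * h n t := fun n => by
    rw [← integral_add_right_eq_self (fun t => φ t * h n (t - ε n)) (ε n)]
    simp
  simp_rw [heq] at lim1
  have hsplit : ∀ c : ℝ → ℝ, AEStronglyMeasurable (fun t => Real.arctan (c t))
      (volume.restrict (Ioi 0)) → Integrable fun t => φ t * Real.arctan (c t) := fun c hc => by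
    refine hbdint.mono' ?_ (Eventually.of_forall fun t => hdom0 _ _)
    have h1 : (fun t => φ t * Real.arctan (c t))
        = (Ioi 0).indicator fun t => φ t * Real.arctan (c t) := by
      ext t
      by_cases ht : t ∈ Ioi (0 : ℝ)
      · rw [indicator_of_mem ht]
      · rw [indicator_of_notMem ht, hφ0 t (not_lt.1 ht), zero_mul]
    rw [h1, aestronglyMeasurable_indicator_iff measurableSet_Ioi]
    exact hφcont.aestronglyMeasurable.mul hc
  simp only [smul_eq_mul, mul_sub]
  rw [integral_sub (hsplit b hbm) (hsplit e hem), tendsto_nhds_unique lim1 lim2, sub_self]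

/-! ### Truncated kernels and their sections in `L²(0, ∞)`. -/

/-- The region `0 < r < t` on which kernels are considered. -/
def kernelDomain : Set (ℝ × ℝ) := {p | 0 < p.2 ∧ p.2 < p.1}

theorem isOpen_kernelDomain : IsOpen kernelDomain :=
  (isOpen_lt continuous_const continuous_snd).inter (isOpen_lt continuous_snd continuous_fst)

/-- A kernel, extended by zero outside of `0 < r < t`. -/
noncomputable def truncKernel (K : ℝ → ℝ → ℝ) (t r : ℝ) : ℝ :=
  kernelDomain.indicator (fun p => K p.1 p.2) (t, r)

open Classical in
/-- The section `K(t, ·)` of a kernel, as an element of `L²(0, ∞)` supported on `(0, t]`. -/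
noncomputable def kernelLp (K : ℝ → ℝ → ℝ) (t : ℝ) : Lp ℝ 2 timeMeasure :=
  if h : MemLp ((Ioc 0 t).indicator (K t)) 2 timeMeasure then h.toLp else 0

section Truncation

variable {K : ℝ → ℝ → ℝ}

theorem truncKernel_of_lt {t r : ℝ} (hr : 0 < r) (h : r < t) : truncKernel K t r = K t r :=
  indicator_of_mem (s := kernelDomain) ⟨hr, h⟩ _

theorem truncKernel_of_le {t r : ℝ} (h : t ≤ r) : truncKernel K t r = 0 :=
  indicator_of_notMem (s := kernelDomain) (fun h' => not_lt.2 h h'.2) _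

theorem measurable_truncKernel
    (hK : ContinuousOn (fun p : ℝ × ℝ => K p.1 p.2) kernelDomain) :
    Measurable (Function.uncurry (truncKernel K)) := by
  classical
  have h := hK.measurable_piecewise (g := 0) (continuousOn_const (c := (0 : ℝ)))
    isOpen_kernelDomain.measurableSet
  rw [piecewise_eq_indicator] at h
  exact h

theorem memLp_indicator_timeMeasure_iff {a : ℝ} (ha : 0 ≤ a) (c : ℝ) (f : ℝ → ℝ) :
    MemLp ((Ioc a c).indicator f) 2 timeMeasure ↔ MemLp f 2 (volume.restrict (Ioc a c)) := by
  rw [memLp_indicator_iff_restrict measurableSet_Ioc, timeMeasure,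
    Measure.restrict_restrict measurableSet_Ioc,
    inter_eq_left.2 fun x hx => mem_Ioi.2 (ha.trans_lt hx.1)]

theorem wienerIntegral_eq_wienerMap_kernelLp {Ω : Type*} [MeasurableSpace Ω] {P : Measure Ω}
    {B : ℝ≥0 → Ω → ℝ} (hB : IsPreBrownianReal B P) (t : ℝ) :
    wienerIntegral hB 0 t (K t) = wienerMap hB (kernelLp K t) := by
  unfold wienerIntegral kernelLp
  split_ifs <;> simp

theorem coeFn_kernelLp (hK2 : ∀ t, 0 < t → MemLp (K t) 2 (volume.restrict (Ioc 0 t))) (t : ℝ) :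
    kernelLp K t =ᵐ[timeMeasure] truncKernel K t := by
  have h : MemLp ((Ioc 0 t).indicator (K t)) 2 timeMeasure := by
    rcases le_or_gt t 0 with ht | ht
    · simp [Ioc_eq_empty (not_lt.2 ht)]
    · exact (memLp_indicator_timeMeasure_iff le_rfl t _).2 (hK2 t ht)
  rw [kernelLp, dif_pos h]
  -- The indicator of `(0, t]` and the truncation to `r < t` differ at most at the null point `r =
  -- t`.
  have hne : ∀ᵐ r ∂timeMeasure, r ≠ t := ae_restrict_of_ae (Measure.ae_ne volume t)
  filter_upwards [h.coeFn_toLp, ae_restrict_mem measurableSet_Ioi, hne] with r hr hr0 hrt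
  rw [hr]
  rcases lt_or_gt_of_ne hrt with hlt | hgt
  · rw [truncKernel_of_lt hr0 hlt, indicator_of_mem (mem_Ioc.2 ⟨hr0, hlt.le⟩)]
  · rw [truncKernel_of_le hgt.le, indicator_of_notMem fun h' => not_le.2 hgt h'.2]

theorem norm_kernelLp {t : ℝ} (ht : 0 < t) (h : MemLp (K t) 2 (volume.restrict (Ioc 0 t))) :
    ‖kernelLp K t‖ = √(∫ r in (0 : ℝ)..t, |K t r| ^ 2) := by
  have h' := (memLp_indicator_timeMeasure_iff le_rfl t (K t)).2 h
  rw [kernelLp, dif_pos h', norm_eq_sqrt_integral_sq h'.coeFn_toLp,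
    intervalIntegral.integral_of_le ht.le]
  congr 1
  have h1 : (fun r => (Ioc 0 t).indicator (K t) r ^ 2)
      = (Ioc 0 t).indicator fun r => |K t r| ^ 2 := by
    ext r
    by_cases hr : r ∈ Ioc 0 t
    · simp [hr]
    · simp [indicator_of_notMem hr]
  rw [h1, integral_indicator measurableSet_Ioc, timeMeasure,
    Measure.restrict_restrict measurableSet_Ioc, Ioc_inter_Ioi_zero]

theorem stronglyMeasurable_kernelLp
    (hK : ContinuousOn (fun p : ℝ × ℝ => K p.1 p.2) kernelDomain)
    (hK2 : ∀ t, 0 < t → MemLp (K t) 2 (volume.restrict (Ioc 0 t))) :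
    StronglyMeasurable (kernelLp K) :=
  stronglyMeasurable_of_kernel (measurable_truncKernel hK) (coeFn_kernelLp hK2)

/-- The square root is exactly the `L²` norm of the section, so the scalar integrability conditions
on `Υ` and on its derivative become Bochner integrability, with weight `(t - s)^(α - 1)` or `1`. -/
theorem intervalIntegrable_smul_kernelLp
    (hK : ContinuousOn (fun p : ℝ × ℝ => K p.1 p.2) kernelDomain)
    (hK2 : ∀ t, 0 < t → MemLp (K t) 2 (volume.restrict (Ioc 0 t)))
    {w : ℝ → ℝ} (hw : Measurable w) {a c : ℝ} (ha : 0 ≤ a) (hac : a ≤ c)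
    (h : IntervalIntegrable (fun s => w s * √(∫ r in (0 : ℝ)..s, |K s r| ^ 2)) volume a c) :
    IntervalIntegrable (fun s => w s • kernelLp K s) volume a c := by
  rw [intervalIntegrable_iff_integrableOn_Ioc_of_le hac] at h ⊢
  refine Integrable.mono h (hw.stronglyMeasurable.smul
    (stronglyMeasurable_kernelLp hK hK2)).aestronglyMeasurable ?_
  filter_upwards [ae_restrict_mem measurableSet_Ioc] with s hs
  have hs0 : 0 < s := ha.trans_lt hs.1
  rw [norm_smul, norm_mul, norm_kernelLp hs0 (hK2 s hs0), Real.norm_of_nonneg (Real.sqrt_nonneg _)]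

theorem measurable_smul_truncKernel
    (hK : ContinuousOn (fun p : ℝ × ℝ => K p.1 p.2) kernelDomain)
    {w : ℝ → ℝ} (hw : Measurable w) :
    Measurable (Function.uncurry fun s r => w s * truncKernel K s r) :=
  (hw.comp measurable_fst).mul (measurable_truncKernel hK)

theorem coeFn_smul_kernelLp (hK2 : ∀ t, 0 < t → MemLp (K t) 2 (volume.restrict (Ioc 0 t)))
    (w : ℝ → ℝ) (s : ℝ) :
    (w s • kernelLp K s : Lp ℝ 2 timeMeasure) =ᵐ[timeMeasure]
      fun r => w s * truncKernel K s r := by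
  filter_upwards [Lp.coeFn_smul (w s) (kernelLp K s), coeFn_kernelLp hK2 s] with r h1 h2
  rw [h1, Pi.smul_apply, h2, smul_eq_mul]

theorem ae_intervalIntegrable_truncKernel
    (hK : ContinuousOn (fun p : ℝ × ℝ => K p.1 p.2) kernelDomain)
    (hK2 : ∀ t, 0 < t → MemLp (K t) 2 (volume.restrict (Ioc 0 t)))
    {w : ℝ → ℝ} (hw : Measurable w) {a c : ℝ} (hac : a ≤ c)
    (h : IntervalIntegrable (fun s => w s • kernelLp K s) volume a c) :
    ∀ᵐ r ∂timeMeasure, IntervalIntegrable (fun s => w s * truncKernel K s r) volume a c := by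
  simp_rw [intervalIntegrable_iff_integrableOn_Ioc_of_le hac] at h ⊢
  exact ae_integrable_of_kernel (measurable_smul_truncKernel hK hw) (coeFn_smul_kernelLp hK2 w) h

theorem coeFn_intervalIntegral_smul_kernelLp
    (hK : ContinuousOn (fun p : ℝ × ℝ => K p.1 p.2) kernelDomain)
    (hK2 : ∀ t, 0 < t → MemLp (K t) 2 (volume.restrict (Ioc 0 t)))
    {w : ℝ → ℝ} (hw : Measurable w) {a c : ℝ} (hac : a ≤ c)
    (h : IntervalIntegrable (fun s => w s • kernelLp K s) volume a c) :
    ((∫ s in a..c, w s • kernelLp K s : Lp ℝ 2 timeMeasure) : ℝ → ℝ) =ᵐ[timeMeasure]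
      fun r => ∫ s in a..c, w s * truncKernel K s r := by
  simp_rw [intervalIntegral.integral_of_le hac]
  rw [intervalIntegrable_iff_integrableOn_Ioc_of_le hac] at h
  exact coeFn_integral_of_kernel (measurable_smul_truncKernel hK hw) (coeFn_smul_kernelLp hK2 w) h

/-- This lemma and the next two cover `r` to the right of, to the left of, and inside the interval
of integration; the truncation removes the times `s ≤ r`. -/
theorem intervalIntegral_truncKernel_of_le {w : ℝ → ℝ} {a c r : ℝ} (hac : a ≤ c) (hcr : c ≤ r) :
    ∫ s in a..c, w s * truncKernel K s r = 0 := by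
  rw [intervalIntegral.integral_of_le hac]
  refine setIntegral_eq_zero_of_forall_eq_zero fun s hs => ?_
  rw [truncKernel_of_le (hs.2.trans hcr), mul_zero]

theorem intervalIntegral_truncKernel_of_ge {w : ℝ → ℝ} {a c r : ℝ} (hr : 0 < r) (hac : a ≤ c)
    (hra : r ≤ a) : ∫ s in a..c, w s * truncKernel K s r = ∫ s in a..c, w s * K s r := by
  rw [intervalIntegral.integral_of_le hac, intervalIntegral.integral_of_le hac]
  refine setIntegral_congr_fun measurableSet_Ioc fun s hs => ?_
  simp only [truncKernel_of_lt hr (hra.trans_lt hs.1)]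

theorem intervalIntegral_truncKernel_of_mem {w : ℝ → ℝ} {a c r : ℝ} (hr : 0 < r) (har : a ≤ r)
    (hrc : r ≤ c) : ∫ s in a..c, w s * truncKernel K s r = ∫ s in r..c, w s * K s r := by
  rw [← intervalIntegral_truncKernel_of_ge hr hrc le_rfl,
    intervalIntegral.integral_of_le (har.trans hrc), intervalIntegral.integral_of_le hrc]
  refine setIntegral_eq_of_subset_of_forall_sdiff_eq_zero measurableSet_Ioc
    (Ioc_subset_Ioc_left har) fun s hs => ?_
  rw [truncKernel_of_le (not_lt.1 fun h => hs.2 ⟨h, hs.1.2⟩), mul_zero]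

/-! ### Fractional integrals of the kernel, recovered from their time derivatives. -/

/-- A function with continuous derivative on `(r, ∞)`, integrable at `r`, has a limit at `r` and
is recovered from it by integration. -/
theorem exists_tendsto_and_eq_add_integral {F F' : ℝ → ℝ} {r : ℝ}
    (hF : ∀ t, r < t → HasDerivAt F (F' t) t)
    (hint : ∀ t, r < t → IntervalIntegrable F' volume r t) :
    ∃ e, Tendsto F (𝓝[>] r) (𝓝 e) ∧ ∀ t, r < t → F t = e + ∫ u in r..t, F' u := by
  have h1 : r < r + 1 := by linarith
  -- Differentiability fails to reach `r`, so the fundamental theorem of calculus is anchored at the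
  -- interior point `r + 1`.
  have hrep : ∀ t, r < t → F t = (F (r + 1) - ∫ u in r..(r + 1), F' u) + ∫ u in r..t, F' u := by
    intro t ht
    have h2 := intervalIntegral.integral_eq_sub_of_hasDerivAt (a := r + 1) (b := t) (f := F)
      (f' := F') (fun x hx => hF x ?_) ((hint _ h1).symm.trans (hint _ ht))
    · rw [← intervalIntegral.integral_add_adjacent_intervals (hint _ h1).symm (hint _ ht),
        intervalIntegral.integral_symm] at h2
      linarith
    · exact (lt_min h1 ht).trans_le hx.1
  refine ⟨_, ?_, hrep⟩
  have h2 := intervalIntegral.continuousOn_primitive_interval' (hint _ h1) left_mem_uIcc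
    r left_mem_uIcc
  have h3 : Tendsto (fun t => ∫ u in r..t, F' u) (𝓝[>] r) (𝓝 0) := by
    rw [ContinuousWithinAt, intervalIntegral.integral_same, uIcc_of_le h1.le] at h2
    refine h2.mono_left ?_
    rw [← nhdsWithin_Ioc_eq_nhdsGT h1]
    exact nhdsWithin_mono _ Ioc_subset_Icc_self
  have h4 := h3.const_add (F (r + 1) - ∫ u in r..(r + 1), F' u)
  rw [add_zero] at h4
  refine h4.congr' ?_
  filter_upwards [self_mem_nhdsWithin] with t ht using (hrep t ht).symm

section RiemannLiouville

variable {α : ℝ} {Υ : ℝ → ℝ → ℝ} {b : ℝ → ℝ}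

theorem measurable_rpow_sub (p t : ℝ) : Measurable fun s : ℝ => (t - s) ^ p :=
  (measurable_const.sub measurable_id).pow_const p

theorem hasDerivAt_rlIntegral_kernel {t r : ℝ}
    (h : HasRLDeriv (1 - α) r (fun s => Υ s r) t) :
    HasDerivAt (rlIntegral α r fun s => Υ s r) (kernelDeriv α Υ t r) t := by
  have h1 := h.2.hasDerivAt
  rw [kernelDeriv, rlDeriv]
  rwa [sub_sub_cancel] at h1 ⊢

/-- A jointly measurable version of the fractional integrals of a kernel. -/
theorem exists_measurable_rlIntegral
    (hΥ : ContinuousOn (fun p : ℝ × ℝ => Υ p.1 p.2) kernelDomain) :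
    ∃ G : ℝ → ℝ → ℝ, Measurable (Function.uncurry G) ∧
      ∀ t r, 0 < r → r < t → G t r = rlIntegral α r (fun s => Υ s r) t := by
  -- Cutting off at `s ≤ t` and truncating at `r < s` turns the integral with moving terminals into
  -- one over the whole line, measurable in its parameters.
  let H : ℝ × ℝ → ℝ → ℝ := fun p s =>
    {q : (ℝ × ℝ) × ℝ | q.2 ≤ q.1.1}.indicator
      (fun q => (q.1.1 - q.2) ^ (α - 1) * truncKernel Υ q.2 q.1.2) (p, s)
  have hH : Measurable (Function.uncurry H) := by
    refine Measurable.indicator ?_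
      (measurableSet_le measurable_snd (measurable_fst.comp measurable_fst))
    refine Measurable.mul ?_ ((measurable_truncKernel hΥ).comp
      (measurable_snd.prodMk (measurable_snd.comp measurable_fst)))
    exact ((measurable_fst.comp measurable_fst).sub measurable_snd).pow_const _
  refine ⟨fun t r => (Real.Gamma α)⁻¹ * ∫ s, H (t, r) s, ?_, fun t r hr hrt => ?_⟩
  · exact (hH.stronglyMeasurable.integral_prod_right (ν := volume)).measurable.const_mul _
  · rw [rlIntegral, smul_eq_mul]
    refine congrArg ((Real.Gamma α)⁻¹ * ·) ?_
    simp only [smul_eq_mul]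
    rw [← intervalIntegral_truncKernel_of_ge hr hrt.le le_rfl,
      intervalIntegral.integral_of_le hrt.le, ← integral_indicator measurableSet_Ioc]
    refine integral_congr_ae (Eventually.of_forall fun s => ?_)
    by_cases hst : s ≤ t
    · by_cases hrs : r < s
      · rw [indicator_of_mem (mem_Ioc.2 ⟨hrs, hst⟩)]
        exact indicator_of_mem (s := {q : (ℝ × ℝ) × ℝ | q.2 ≤ q.1.1}) hst _
      · rw [indicator_of_notMem fun h => hrs h.1]
        refine (indicator_of_mem (s := {q : (ℝ × ℝ) × ℝ | q.2 ≤ q.1.1}) hst _).trans ?_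
        simp only [truncKernel_of_le (not_lt.1 hrs), mul_zero]
    · rw [indicator_of_notMem fun h => hst h.2]
      exact indicator_of_notMem (s := {q : (ℝ × ℝ) × ℝ | q.2 ≤ q.1.1}) hst _

/-- The lower terminal moves from `0` to `r` because sections at times `s ≤ r` vanish at `r`. -/
theorem coeFn_rlIntegral_kernelLp
    (hΥ : ContinuousOn (fun p : ℝ × ℝ => Υ p.1 p.2) kernelDomain)
    (hΥ2 : ∀ t, 0 < t → MemLp (Υ t) 2 (volume.restrict (Ioc 0 t))) {t : ℝ} (ht : 0 < t)
    (hint : IntervalIntegrable (fun s => (t - s) ^ (α - 1) • kernelLp Υ s) volume 0 t) :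
    (rlIntegral α 0 (kernelLp Υ) t : Lp ℝ 2 timeMeasure) =ᵐ[timeMeasure]
      (Iio t).indicator fun r => rlIntegral α r (fun s => Υ s r) t := by
  filter_upwards [Lp.coeFn_smul (Real.Gamma α)⁻¹ (∫ s in (0 : ℝ)..t,
      (t - s) ^ (α - 1) • kernelLp Υ s), coeFn_intervalIntegral_smul_kernelLp hΥ hΥ2
      (measurable_rpow_sub (α - 1) t) ht.le hint, ae_restrict_mem measurableSet_Ioi]
    with r h1 h2 hr
  rw [rlIntegral, h1, Pi.smul_apply, h2]
  by_cases hrt : r < t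
  · rw [indicator_of_mem (mem_Iio.2 hrt), rlIntegral,
      intervalIntegral_truncKernel_of_mem hr (le_of_lt hr) hrt.le]
    simp only [smul_eq_mul]
  · rw [indicator_of_notMem fun h => hrt (mem_Iio.1 h),
      intervalIntegral_truncKernel_of_le ht.le (not_lt.1 hrt),
      smul_zero]

/-- Sections are integrable in time only away from `0`, and the null set must not depend on `t`. The
countably many intervals `[1/(n+1), n+1]` meet both constraints: one of them contains `[r, t]`, and
the truncation makes integrability there include the endpoint `r`. -/
theorem ae_intervalIntegrable_kernel
    (hK : ContinuousOn (fun p : ℝ × ℝ => K p.1 p.2) kernelDomain)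
    (hK2 : ∀ t, 0 < t → MemLp (K t) 2 (volume.restrict (Ioc 0 t)))
    (hint : ∀ s t, 0 < s → s ≤ t → IntervalIntegrable (kernelLp K) volume s t) :
    ∀ᵐ r ∂timeMeasure, ∀ t, r < t → IntervalIntegrable (fun u => K u r) volume r t := by
  have h : ∀ᵐ r ∂timeMeasure, ∀ n : ℕ, IntervalIntegrable
      (fun s => (1 : ℝ) * truncKernel K s r) volume (1 / ((n : ℝ) + 1)) ((n : ℝ) + 1) := by
    refine ae_all_iff.2 fun n => ?_
    have hn : 1 / ((n : ℝ) + 1) ≤ (n : ℝ) + 1 := by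
      rw [div_le_iff₀ (by positivity)]
      nlinarith [(Nat.cast_nonneg n : (0 : ℝ) ≤ n)]
    refine ae_intervalIntegrable_truncKernel hK hK2 (w := fun _ => 1) measurable_const hn ?_
    simpa only [one_smul] using hint _ _ (by positivity) hn
  filter_upwards [h, ae_restrict_mem measurableSet_Ioi] with r hr hr0 t hrt
  obtain ⟨n, hn⟩ := exists_nat_one_div_lt (mem_Ioi.1 hr0)
  obtain ⟨m, hm⟩ := exists_nat_ge t
  have h1 := hr (max n m)
  have hn' : 1 / (((max n m : ℕ) : ℝ) + 1) ≤ r :=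
    (one_div_le_one_div_of_le (by positivity) (by gcongr; exact le_max_left n m)).trans hn.le
  have hm' : t ≤ ((max n m : ℕ) : ℝ) + 1 := by
    have : (m : ℝ) ≤ ((max n m : ℕ) : ℝ) := by gcongr; exact le_max_right n m
    linarith
  have h2 := h1.mono_set (c := r) (d := t) (by
    rw [uIcc_of_le hrt.le, uIcc_of_le (hn'.trans (hrt.le.trans hm'))]
    exact Icc_subset_Icc hn' hm')
  refine h2.congr_ae ?_
  rw [uIoc_of_le hrt.le]
  filter_upwards [ae_restrict_mem measurableSet_Ioc] with s hs
  rw [one_mul, truncKernel_of_lt hr0 hs.1]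

/-- Almost every fractional integral of the kernel is recovered from its derivative and its
limit at the diagonal, which may be taken from either side. -/
theorem ae_rlIntegral_eq_add_integral
    (hDex : ∀ t r, 0 < r → r < t → HasRLDeriv (1 - α) r (fun s => Υ s r) t)
    (hΥ : ContinuousOn (fun p : ℝ × ℝ => Υ p.1 p.2) kernelDomain)
    (hint : ∀ᵐ r ∂timeMeasure, ∀ t, r < t →
      IntervalIntegrable (fun u => kernelDeriv α Υ u r) volume r t)
    (hb : ∀ t, 0 < t →
      Tendsto (fun r => rlIntegral α r (fun s => Υ s r) t) (𝓝[<] t) (𝓝 (b t))) :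
    ∀ᵐ r ∂timeMeasure, ∀ t, r < t →
      rlIntegral α r (fun s => Υ s r) t = b r + ∫ u in r..t, kernelDeriv α Υ u r := by
  obtain ⟨G, hG, hGeq⟩ := exists_measurable_rlIntegral (α := α) hΥ
  have hlim : ∀ᵐ r ∂timeMeasure, ∃ e,
      Tendsto (rlIntegral α r fun s => Υ s r) (𝓝[>] r) (𝓝 e) ∧
      ∀ t, r < t → rlIntegral α r (fun s => Υ s r) t
        = e + ∫ u in r..t, kernelDeriv α Υ u r := by
    filter_upwards [hint, ae_restrict_mem measurableSet_Ioi] with r hr hr0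
    exact exists_tendsto_and_eq_add_integral
      (fun t ht => hasDerivAt_rlIntegral_kernel (hDex t r hr0 ht)) hr
  have hlim' := hlim
  rw [ae_restrict_iff' measurableSet_Ioi] at hlim'
  -- `limUnder` turns the a.e. existing limit into a function of `r`; its default values matter only
  -- on a null set.
  have hbe := ae_eq_of_tendsto_diagonal hG (b := b)
    (e := fun r => limUnder (𝓝[>] r) (rlIntegral α r fun s => Υ s r)) (fun t ht => ?_) ?_
  · filter_upwards [hlim, (ae_restrict_iff' measurableSet_Ioi).2 hbe] with r hr hbr
    obtain ⟨e, he, heq⟩ := hr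
    rwa [hbr, he.limUnder_eq]
  · refine (hb t ht).congr' ?_
    filter_upwards [Ioo_mem_nhdsLT ht] with r hr using (hGeq t r hr.1 hr.2).symm
  · filter_upwards [hlim'] with r hr hr0
    obtain ⟨e, he, -⟩ := hr hr0
    rw [he.limUnder_eq]
    refine he.congr' ?_
    filter_upwards [self_mem_nhdsWithin] with t ht using (hGeq t r hr0 ht).symm

/-- The deterministic form of the theorem, before the Wiener integral is applied. -/
theorem ae_rlIntegral_kernelLp_sub
    (hDex : ∀ t r, 0 < r → r < t → HasRLDeriv (1 - α) r (fun s => Υ s r) t)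
    (hΥ : ContinuousOn (fun p : ℝ × ℝ => Υ p.1 p.2) kernelDomain)
    (hD : ContinuousOn (fun p : ℝ × ℝ => kernelDeriv α Υ p.1 p.2) kernelDomain)
    (hΥ2 : ∀ t, 0 < t → MemLp (Υ t) 2 (volume.restrict (Ioc 0 t)))
    (hD2 : ∀ t, 0 < t → MemLp (kernelDeriv α Υ t) 2 (volume.restrict (Ioc 0 t)))
    (hDint : ∀ s t, 0 < s → s ≤ t → IntervalIntegrable (kernelLp (kernelDeriv α Υ)) volume s t)
    (hΥint : ∀ t, 0 < t →
      IntervalIntegrable (fun s => (t - s) ^ (α - 1) • kernelLp Υ s) volume 0 t)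
    (hb : ∀ t, 0 < t →
      Tendsto (fun r => rlIntegral α r (fun s => Υ s r) t) (𝓝[<] t) (𝓝 (b t)))
    {s t : ℝ} (hs : 0 < s) (hst : s ≤ t) :
    (rlIntegral α 0 (kernelLp Υ) t - rlIntegral α 0 (kernelLp Υ) s
        - ∫ u in s..t, kernelLp (kernelDeriv α Υ) u : Lp ℝ 2 timeMeasure) =ᵐ[timeMeasure]
      (Ioc s t).indicator b := by
  have hDii := ae_intervalIntegrable_kernel hD hD2 hDint
  have hA := coeFn_intervalIntegral_smul_kernelLp hD hD2 (w := fun _ => 1) measurable_const hst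
    (by simpa only [one_smul] using hDint s t hs hst)
  simp only [one_smul, one_mul] at hA
  have hne : ∀ᵐ r ∂timeMeasure, r ≠ t := ae_restrict_of_ae (Measure.ae_ne volume t)
  have hne' : ∀ᵐ r ∂timeMeasure, r ≠ s := ae_restrict_of_ae (Measure.ae_ne volume s)
  filter_upwards [Lp.coeFn_sub (rlIntegral α 0 (kernelLp Υ) t - rlIntegral α 0 (kernelLp Υ) s)
      (∫ u in s..t, kernelLp (kernelDeriv α Υ) u),
    Lp.coeFn_sub (rlIntegral α 0 (kernelLp Υ) t) (rlIntegral α 0 (kernelLp Υ) s), hA,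
    coeFn_rlIntegral_kernelLp hΥ hΥ2 (hs.trans_le hst) (hΥint t (hs.trans_le hst)),
    coeFn_rlIntegral_kernelLp hΥ hΥ2 hs (hΥint s hs), hDii,
    ae_rlIntegral_eq_add_integral hDex hΥ hDii hb, ae_restrict_mem measurableSet_Ioi, hne, hne']
    with r h1 h2 h3 h4 h5 hDr hI hr0 hrt hrs
  rw [h1, Pi.sub_apply, h2, Pi.sub_apply, h3, h4, h5]
  have hge := fun h => intervalIntegral_truncKernel_of_ge (K := kernelDeriv α Υ) (w := fun _ => 1)
    hr0 hst (r := r) h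
  have hmem := fun h h' => intervalIntegral_truncKernel_of_mem (K := kernelDeriv α Υ)
    (w := fun _ => 1) hr0 (a := s) (c := t) (r := r) h h'
  have hle := fun h => intervalIntegral_truncKernel_of_le (K := kernelDeriv α Υ) (w := fun _ => 1)
    hst (r := r) h
  simp only [one_mul] at hge hmem hle
  -- For `r < s` the value `b r` occurs in both fractional integrals and cancels; for `s < r < t`
  -- only the one at `t` is nonzero and leaves `b r`; for `r > t` everything vanishes.
  rcases lt_or_gt_of_ne hrs with hlt | hgt
  · have hlt' := hlt.trans_le hst
    rw [indicator_of_mem (mem_Iio.2 hlt), indicator_of_mem (mem_Iio.2 hlt'),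
      indicator_of_notMem fun h => lt_asymm hlt h.1, hge hlt.le, hI t hlt', hI s hlt,
      ← intervalIntegral.integral_interval_sub_left (hDr t hlt') (hDr s hlt)]
    ring
  · rw [indicator_of_notMem fun h => lt_asymm hgt (mem_Iio.1 h)]
    rcases lt_or_gt_of_ne hrt with hlt' | hgt'
    · rw [indicator_of_mem (mem_Iio.2 hlt'), indicator_of_mem (mem_Ioc.2 ⟨hgt, hlt'.le⟩),
        hmem hgt.le hlt'.le, hI t hlt']
      ring
    · rw [indicator_of_notMem fun h => lt_asymm hgt' (mem_Iio.1 h),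
        indicator_of_notMem fun h => not_lt.2 h.2 hgt', hle hgt'.le]
      ring

end RiemannLiouville

end Truncation

/-! ### Transfer to `L²(Ω)` through the Wiener integral. -/

theorem ContinuousLinearMap.intervalIntegrable_comp {E F : Type*}
    [NormedAddCommGroup E] [NormedSpace ℝ E] [NormedAddCommGroup F] [NormedSpace ℝ F] (L : E →L[ℝ] F) {f : ℝ → E} {a b : ℝ}
    (h : IntervalIntegrable f volume a b) : IntervalIntegrable (fun s => L (f s)) volume a b :=
  ⟨L.integrable_comp h.1, L.integrable_comp h.2⟩

theorem theorem2p6 {Ω : Type*} [MeasurableSpace Ω] {P : Measure Ω} {B : ℝ≥0 → Ω → ℝ}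
    (hB : IsPreBrownianReal B P)
    (α : ℝ) (hα0 : 0 < α) (hα1 : α < 1)
    (Υ : ℝ → ℝ → ℝ) (b : ℝ → ℝ)
    -- `Υ(t, r)` and its fractional derivative exist and are continuous on `0 < r < t`
    (hDex : ∀ t r, 0 < r → r < t → HasRLDeriv (1 - α) r (fun s => Υ s r) t)
    (hΥcont : ContinuousOn (fun p : ℝ × ℝ => Υ p.1 p.2) {p | 0 < p.2 ∧ p.2 < p.1})
    (hDcont : ContinuousOn (fun p : ℝ × ℝ => kernelDeriv α Υ p.1 p.2) {p | 0 < p.2 ∧ p.2 < p.1})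
    -- the two stochastic integrals are well defined
    (hΥint : ∀ t, 0 < t → MemLp (Υ t) 2 (volume.restrict (Ioc 0 t)))
    (hDint : ∀ t, 0 < t → MemLp (kernelDeriv α Υ t) 2 (volume.restrict (Ioc 0 t)))
    -- the second one is the drift of a stochastic differential on `(0, ∞)`
    (hdrift : ∀ s t, 0 < s → s < t →
      IntervalIntegrable (fun u => √(∫ r in (0 : ℝ)..u, |kernelDeriv α Υ u r| ^ 2)) volume s t)
    -- the integrability condition
    (hFubini : ∀ t, 0 < t → IntervalIntegrable
      (fun s => (t - s) ^ (α - 1) * √(∫ r in (0 : ℝ)..s, |Υ s r| ^ 2)) volume 0 t)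
    -- `b(t)` is the limit as `r ↑ t` of the `α`-fold integral of `Υ(·, r)` over `(r, t)`
    (hb : ∀ t, 0 < t →
      Tendsto (fun r => rlIntegral α r (fun s => Υ s r) t) (𝓝[<] t) (𝓝 (b t))) :
    -- the processes `X(t) = ∫_0^t Υ(t, r) dB(r)` and `A(t) = ∫_0^t ᵣD_t^{1-α}Υ(t, r) dB(r)`
    let X : ℝ → Lp ℝ 2 P := fun t => wienerIntegral hB 0 t (Υ t)
    let A : ℝ → Lp ℝ 2 P := fun t => wienerIntegral hB 0 t (kernelDeriv α Υ t)
    -- the fractional integral of `X`, whose differential is `(D_t^{1-α} X) dt`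
    let J : ℝ → Lp ℝ 2 P := rlIntegral α 0 X
    -- all the integrals below exist
    (∀ t, 0 < t → IntervalIntegrable (fun s => (t - s) ^ (α - 1) • X s) volume 0 t) ∧
    (∀ s t, 0 < s → s ≤ t → IntervalIntegrable A volume s t) ∧
    (∀ s t, 0 < s → s ≤ t → MemLp b 2 (volume.restrict (Ioc s t))) ∧
    -- `dJ = A dt + b dB`: equality of the increments almost surely ...
    (∀ s t, 0 < s → s ≤ t →
      J t - J s = (∫ u in s..t, A u) + wienerIntegral hB s t b) ∧
    -- ... and in distribution, jointly for any finite family of time intervals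
    (∀ (n : ℕ) (s t : Fin n → ℝ), (∀ i, 0 < s i ∧ s i ≤ t i) →
      IdentDistrib (fun ω i => (J (t i) - J (s i) : Lp ℝ 2 P) ω)
        (fun ω i => ((∫ u in (s i)..(t i), A u) + wienerIntegral hB (s i) (t i) b : Lp ℝ 2 P) ω)
        P P) := by
  intro X A J
  have hX : X = fun t => wienerMap hB (kernelLp Υ t) :=
    funext fun t => wienerIntegral_eq_wienerMap_kernelLp hB t
  have hA : A = fun t => wienerMap hB (kernelLp (kernelDeriv α Υ) t) :=
    funext fun t => wienerIntegral_eq_wienerMap_kernelLp hB t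
  have hΥi : ∀ t, 0 < t →
      IntervalIntegrable (fun s => (t - s) ^ (α - 1) • kernelLp Υ s) volume 0 t := fun t ht =>
    intervalIntegrable_smul_kernelLp hΥcont hΥint (measurable_rpow_sub _ t) le_rfl ht.le
      (hFubini t ht)
  have hDi : ∀ s t, 0 < s → s ≤ t →
      IntervalIntegrable (kernelLp (kernelDeriv α Υ)) volume s t := by
    intro s t hs hst
    rcases hst.eq_or_lt with rfl | hlt
    · exact IntervalIntegrable.refl
    · have h := intervalIntegrable_smul_kernelLp hDcont hDint (w := fun _ => 1) measurable_const
        hs.le hst (by simpa only [one_mul] using hdrift s t hs hlt)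
      simpa only [one_smul] using h
  have hXi : ∀ t, 0 < t →
      IntervalIntegrable (fun s => (t - s) ^ (α - 1) • X s) volume 0 t := by
    intro t ht
    have h := (wienerMap hB).intervalIntegrable_comp (hΥi t ht)
    simpa only [hX, map_smul] using h
  have hAi : ∀ s t, 0 < s → s ≤ t → IntervalIntegrable A volume s t := fun s t hs hst => by
    rw [hA]
    exact (wienerMap hB).intervalIntegrable_comp (hDi s t hs hst)
  have hJ : ∀ t, 0 < t → J t = wienerMap hB (rlIntegral α 0 (kernelLp Υ) t) := by
    intro t ht
    simp only [J, rlIntegral, hX]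
    rw [map_smul, ← ContinuousLinearMap.intervalIntegral_comp_comm _ (hΥi t ht)]
    simp only [map_smul]
  have hdiff : ∀ s t : ℝ, 0 < s → s ≤ t → _ := fun s t hs hst =>
    ae_rlIntegral_kernelLp_sub hDex hΥcont hDcont hΥint hDint hDi hΥi hb hs hst
  -- Square integrability of `b` is a consequence: on `(s, t]` it is a.e. equal to an element of
  -- `L²(0, ∞)`.
  have hbind : ∀ s t, 0 < s → s ≤ t → MemLp ((Ioc s t).indicator b) 2 timeMeasure :=
    fun s t hs hst => (memLp_congr_ae (hdiff s t hs hst)).1 (Lp.memLp _)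
  have hincr : ∀ s t, 0 < s → s ≤ t →
      J t - J s = (∫ u in s..t, A u) + wienerIntegral hB s t b := by
    intro s t hs hst
    have h1 : (hbind s t hs hst).toLp = rlIntegral α 0 (kernelLp Υ) t
        - rlIntegral α 0 (kernelLp Υ) s - ∫ u in s..t, kernelLp (kernelDeriv α Υ) u :=
      Lp.ext ((hbind s t hs hst).coeFn_toLp.trans (hdiff s t hs hst).symm)
    rw [wienerIntegral, dif_pos (hbind s t hs hst), h1, hA,
      ContinuousLinearMap.intervalIntegral_comp_comm _ (hDi s t hs hst),
      hJ t (hs.trans_le hst), hJ s hs, map_sub, map_sub]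
    abel
  refine ⟨hXi, hAi, fun s t hs hst =>
    (memLp_indicator_timeMeasure_iff hs.le t b).1 (hbind s t hs hst), hincr, fun n s t hst => ?_⟩
  -- The increments agree as elements of `L²(Ω)`, so the two random vectors become the same one.
  simp_rw [← hincr _ _ (hst _).1 (hst _).2]
  exact IdentDistrib.refl (aemeasurable_pi_lambda _ fun i =>
    (Lp.aestronglyMeasurable (J (t i) - J (s i))).aemeasurable)
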